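/- Let $\mathcal S=(S;\dots)$ be a first-order structure, let $n\in\mathbb N$, and let $\mathrm{Def}(\mathcal S)$ be the boolean algebra of subsets of $S^n$ that are definable in $\mathcal S$ with parameters. Fix a set $\mathcal I_n$ of definable bijections $S^n\to S^n$ that forms a group under composition; its elements are called isomorphisms. For a finite index set $J$, regard $J\times S^n$ as a disjoint union of copies of $S^n$, and call $Y\subseteq J\times S^n$ definable if each $\{x\in S^n : (j,x)\in Y\}$, $j\in J$, is definable. Identify $S^n$ with $\{*\}\times S^n$. For $k\in\mathbb N$, let $kY\subseteq(\{1,\dots,k\}\times J)\times S^n$ be the union of $k$ disjoint copies of $Y$. For definable $Y\subseteq J\times S^n$ and $Z\subseteq J'\times S^n$ write: * $Y\le Z$ if $Y$ has a finite partition into sets $\{a_t\}\times P_t$ with $a_t\in J$ and $P_t\in\mathrm{Def}(\mathcal S)$, and there are $b_t\in J'$ and $f_t\in\mathcal I_n$ such that the sets $\{b_t\}\times f_t(P_t)$ are pairwise disjoint and contained in $Z$; * $Y\le_m Z$, for an integer $m>0$, if there are integers $p,q>0$ with $m\le p/q$ and $pY\le qZ$; * $Y\le_0 Z$ ("$Y$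 almost embeds into $Z$") if for every integer $m>0$ there is a definable $Y_0\subseteq Y$ such that $Y_0\le_m Y$ and $Y\setminus Y_0\le Z$. **Theorem 1.2.** For every $X\in\mathrm{Def}(\mathcal S)$ the following are equivalent. 1. $2X\not\le_0 X$. 2. There is a map $\mu\colon\mathrm{Def}(\mathcal S)\to[0,\infty]$ with $\mu(\emptyset)=0$, with $\mu(Y\cup Z)=\mu(Y)+\mu(Z)$ for all disjoint $Y,Z\in\mathrm{Def}(\mathcal S)$, and with $\mu(f(Y))=\mu(Y)$ for all $f\in\mathcal I_n$ and $Y\in\mathrm{Def}(\mathcal S)$, such that $\mu(X)=1$. -/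

import Mathlib

open scoped ENNReal

universe u v w

namespace DefinableTarski

/-- `ι × Sⁿ` is a disjoint union of copies of `Sⁿ`, one for each index in `ι` (below, `ι` is always
finite). A subset of it is definable when each of its levels is a definable subset of `Sⁿ`
(definable with parameters from `S`). -/
def IsDefinable (L : FirstOrder.Language.{u, v}) {S : Type w} [L.Structure S] {n : ℕ} {ι : Type}
    (Y : Set (ι × (Fin n → S))) : Prop :=
  ∀ i : ι, (Set.univ : Set S).Definable L {x : Fin n → S | (i, x) ∈ Y}

/-- A definable set `X ⊆ Sⁿ`, as a subset of a single copy of `Sⁿ`. -/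
def single (L : FirstOrder.Language.{u, v}) {S : Type w} [L.Structure S] {n : ℕ}
    (X : L.DefinableSet (Set.univ : Set S) (Fin n)) : Set (Unit × (Fin n → S)) :=
  {z | z.2 ∈ X}

/-- `copies k Y` is `kY`, the union of `k` disjoint copies of `Y`. -/
def copies {V : Type w} {ι : Type} (k : ℕ) (Y : Set (ι × V)) : Set ((Fin k × ι) × V) :=
  {z | (z.1.2, z.2) ∈ Y}

/-- `I` is a set of isomorphisms of `Sⁿ`: a group, under composition, of definable bijections
`Sⁿ → Sⁿ`. -/
def IsIsomorphismGroup (L : FirstOrder.Language.{u, v}) {S : Type w} [L.Structure S] {n : ℕ}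
    (I : Subgroup (Equiv.Perm (Fin n → S))) : Prop :=
  ∀ f ∈ I, (Set.univ : Set S).DefinableMap L (f : (Fin n → S) → (Fin n → S))

/-- `Y ≤ Z`: the set `Y` isomorphically embeds into `Z`. There is a finite partition of `Y` into
definable pieces `{a t} × P t`, each inside one copy of `Sⁿ`, and there are isomorphisms `f t`, such
that the images `{b t} × f t (P t)` are pairwise disjoint subsets of `Z`. -/
def Embeds (L : FirstOrder.Language.{u, v}) {S : Type w} [L.Structure S] {n : ℕ}
    (I : Subgroup (Equiv.Perm (Fin n → S))) {ι κ : Type}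
    (Y : Set (ι × (Fin n → S))) (Z : Set (κ × (Fin n → S))) : Prop :=
  ∃ (r : ℕ) (a : Fin r → ι) (b : Fin r → κ) (P : Fin r → Set (Fin n → S))
    (f : Fin r → Equiv.Perm (Fin n → S)),
    (∀ t, (Set.univ : Set S).Definable L (P t)) ∧
    (∀ t, f t ∈ I) ∧
    Pairwise (fun s t => Disjoint ({a s} ×ˢ P s) ({a t} ×ˢ P t)) ∧
    (⋃ t, {a t} ×ˢ P t) = Y ∧
    Pairwise (fun s t => Disjoint ({b s} ×ˢ (f s '' P s)) ({b t} ×ˢ (f t '' P t))) ∧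
    (⋃ t, {b t} ×ˢ (f t '' P t)) ⊆ Z

/-- `Y ≤ₘ Z`: there are positive integers `p, q` with `m ≤ p / q` and `pY ≤ qZ`. -/
def EmbedsTimes (L : FirstOrder.Language.{u, v}) {S : Type w} [L.Structure S] {n : ℕ}
    (I : Subgroup (Equiv.Perm (Fin n → S))) {ι κ : Type} (m : ℕ)
    (Y : Set (ι × (Fin n → S))) (Z : Set (κ × (Fin n → S))) : Prop :=
  ∃ p q : ℕ, 0 < p ∧ 0 < q ∧ (m : ℚ) ≤ (p : ℚ) / (q : ℚ) ∧
    Embeds L I (copies p Y) (copies q Z)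

/-- `Y ≤₀ Z`: the set `Y` almost embeds into `Z`. -/
def AlmostEmbeds (L : FirstOrder.Language.{u, v}) {S : Type w} [L.Structure S] {n : ℕ}
    (I : Subgroup (Equiv.Perm (Fin n → S))) {ι κ : Type}
    (Y : Set (ι × (Fin n → S))) (Z : Set (κ × (Fin n → S))) : Prop :=
  ∀ m : ℕ, 0 < m → ∃ Y₀ : Set (ι × (Fin n → S)), Y₀ ⊆ Y ∧ IsDefinable L Y₀ ∧
    EmbedsTimes L I m Y₀ Y ∧ Embeds L I (Y \ Y₀) Z

/-- A finitely additive measure on the boolean algebra of definable subsets of `Sⁿ`, with values in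
`[0, ∞]`, that is invariant under isomorphisms. -/
structure IsInvariantMeasure (L : FirstOrder.Language.{u, v}) {S : Type w} [L.Structure S] {n : ℕ}
    (I : Subgroup (Equiv.Perm (Fin n → S)))
    (μ : L.DefinableSet (Set.univ : Set S) (Fin n) → ℝ≥0∞) : Prop where
  empty : μ ⊥ = 0
  additive : ∀ Y Z : L.DefinableSet (Set.univ : Set S) (Fin n),
    Disjoint (Y : Set (Fin n → S)) (Z : Set (Fin n → S)) → μ (Y ⊔ Z) = μ Y + μ Z
  invariant : ∀ f ∈ I, ∀ Y Z : L.DefinableSet (Set.univ : Set S) (Fin n),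
    (Z : Set (Fin n → S)) = f '' (Y : Set (Fin n → S)) → μ Z = μ Y

end DefinableTarski

/-!
A measure normalised at `X` is a state on the type semigroup of the bounded definable sets, and
Tarski's extension theorem (`exists_state`) produces such a state as soon as no `(k + 1) X` embeds
into `k X`. What remains is to compare this condition with almost embeddings of `2 X` into `X`.

If `(k + 1) X` embeds into `k X`, then every multiple `N X` embeds into `k X`, so all of `2 X` is
`≤ₘ 2 X` for every `m`. One may then take `Y₀ = 2 X` in the definition of almost embedding, leaving
the empty set to be embedded (`almostEmbeds_of_countEmbeds`). Hence no cancellation law is needed.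
Conversely, if `μ X = 1` then every `Y₀ ≤₃ 2 X` has measure at most `2 / 3`, and `2 X \ Y₀` has
measure greater than `1`, too large to embed into `X` (`IsInvariantMeasure.not_almostEmbeds`).

The type semigroup is handled through counting functions `Sⁿ → ℕ`: a definable subset of a disjoint
union of copies of `Sⁿ` is determined, up to moving points between copies, by how often it covers
each point. Disjoint unions become sums, and the relation `CountEmbeds` on counting functions is the
counterpart of `Embeds`. It is transitive and implies `Embeds` because inequalities between finite
sums of indicators of definable sets are realised by definable splittings (`exists_splitting`).

The state is obtained by a Hahn–Banach argument carried out directly in the preordered monoid, which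
avoids passing to a vector space and its real coefficients: the monotone sublinear functionals
normalised at `X` (`IsGauge`) form a nonempty family to which Zorn's lemma applies; a minimal one
is additive, since its directional derivatives at infinity are again members of the family.
-/

namespace DefinableTarski

/-! ### States on preordered monoids -/

section States

open Filter Topology

variable {A : Type*} [AddCommMonoid A] [Preorder A]

/-- A gauge normalised at `x`: a monotone, subadditive, `ℕ`-homogeneous real functional which is
additive in the direction `x`, where it takes the value `1`. The minimal gauges turn out to be the
additive ones. -/
structure IsGauge (x : A) (p : A → ℝ) : Prop where
  mono : ∀ ⦃a b⦄, a ≤ b → p a ≤ p b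
  add_le : ∀ a b, p (a + b) ≤ p a + p b
  nsmul : ∀ (k : ℕ) a, p (k • a) = k * p a
  add_unit : ∀ a, p (a + x) = p a + 1

namespace IsGauge

variable {x : A} {p : A → ℝ}

lemma map_zero (hp : IsGauge x p) : p 0 = 0 := by simpa using hp.nsmul 0 0

lemma nonneg (h0 : ∀ a : A, 0 ≤ a) (hp : IsGauge x p) (a : A) : 0 ≤ p a :=
  hp.map_zero ▸ hp.mono (h0 a)

lemma sInf_chain (h0 : ∀ a : A, 0 ≤ a) {C : Set (A → ℝ)} (hC : ∀ q ∈ C, IsGauge x q)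
    (hchain : IsChain (· ≤ ·) C) (hne : C.Nonempty) :
    IsGauge x (fun a => ⨅ q : C, (q : A → ℝ) a) := by
  have : Nonempty C := hne.to_subtype
  have bdd : ∀ a, BddBelow (Set.range fun q : C => (q : A → ℝ) a) := fun a =>
    ⟨0, by rintro _ ⟨q, rfl⟩; exact (hC q q.2).nonneg h0 a⟩
  refine ⟨fun a b hab => ciInf_mono (bdd a) fun q => (hC q q.2).mono hab, fun a b => ?_,
    fun k a => ?_, fun a => ?_⟩
  · refine le_ciInf_add_ciInf fun q r => ?_
    -- the smaller of the two members of the chain serves both arguments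
    rcases hchain.total q.2 r.2 with h | h
    · exact (ciInf_le (bdd _) q).trans
        (((hC q q.2).add_le a b).trans (add_le_add le_rfl (h b)))
    · exact (ciInf_le (bdd _) r).trans
        (((hC r r.2).add_le a b).trans (add_le_add (h a) le_rfl))
  · rw [Real.mul_iInf_of_nonneg k.cast_nonneg]
    exact iInf_congr fun q => (hC q q.2).nsmul k a
  · rw [ciInf_add (bdd a)]
    exact iInf_congr fun q => (hC q q.2).add_unit a

variable [IsOrderedAddMonoid A]

/-- The directional derivative at infinity of a gauge. It is again a gauge, and its value at `b` is
at most `p (b + a) - p a`, so that a minimal gauge is superadditive. -/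
lemma exists_le_sub (h0 : ∀ a : A, 0 ≤ a) (hp : IsGauge x p) (a : A) :
    ∃ q, IsGauge x q ∧ q ≤ p ∧ ∀ b, q b ≤ p (b + a) - p a := by
  set h : A → ℕ → ℝ := fun b t => p (b + t • a) - t * p a with hdef
  have anti : ∀ b, Antitone (h b) := fun b => antitone_nat_of_succ_le fun t => by
    have := hp.add_le (b + t • a) a
    simp only [hdef, succ_nsmul, ← add_assoc]
    push_cast
    linarith
  have bdd : ∀ b, BddBelow (Set.range (h b)) := fun b => ⟨0, by
    rintro _ ⟨t, rfl⟩
    have h1 : p (t • a) ≤ p (b + t • a) := hp.mono (by simpa using add_le_add_left (h0 b) (t • a))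
    rw [hp.nsmul] at h1
    simpa [hdef] using h1⟩
  have lim : ∀ b, Tendsto (h b) atTop (𝓝 (⨅ t, h b t)) := fun b =>
    tendsto_atTop_ciInf (anti b) (bdd b)
  refine ⟨fun b => ⨅ t, h b t, ⟨fun b c hbc => ?_, fun b c => ?_, fun k b => ?_, fun b => ?_⟩,
    fun b => ?_, fun b => ?_⟩
  · exact ciInf_mono (bdd b) fun t => sub_le_sub_right (hp.mono (add_le_add_left hbc _)) _
  · refine ge_of_tendsto' ((lim b).add (lim c)) fun t => (ciInf_le (bdd _) (t + t)).trans ?_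
    have h1 := hp.add_le (b + t • a) (c + t • a)
    rw [add_add_add_comm, ← add_nsmul] at h1
    simp only [hdef]
    push_cast
    linarith
  · rcases k.eq_zero_or_pos with rfl | hk
    · simp [hdef, hp.nsmul]
    -- along the multiples of `k`, homogeneity of `p` factors `k` out
    · have h1 : Tendsto (fun t => h (k • b) (k * t)) atTop (𝓝 (⨅ t, h (k • b) t)) :=
        (lim _).comp (tendsto_id.const_mul_atTop' hk)
      have h2 : (fun t => h (k • b) (k * t)) = fun t => (k : ℝ) * h b t := by
        funext t
        simp only [hdef]
        rw [mul_nsmul', ← nsmul_add, hp.nsmul]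
        push_cast
        ring
      rw [h2] at h1
      exact tendsto_nhds_unique h1 ((lim b).const_mul _)
  · have h1 : h (b + x) = fun t => h b t + 1 := by
      funext t
      simp only [hdef]
      rw [add_right_comm, hp.add_unit]
      ring
    rw [h1]
    exact (ciInf_add (bdd b) 1).symm
  · simpa [hdef] using ciInf_le (bdd b) 0
  · simpa [hdef] using ciInf_le (bdd b) 1

/-- If no multiple `(k + 1) • x` of an order unit lies below `k • x`, then there is a gauge
normalised at `x`. Counting by whole copies of `x` gives the subadditive function
`N a = min {d | ∃ c, a + c • x ≤ (c + d) • x}`, and the gauge is its homogenisation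
`lim N (b • a) / b`, given by Fekete's lemma. -/
lemma exists_of_not_le (h0 : ∀ a : A, 0 ≤ a) (hx : ∀ a, ∃ k : ℕ, a ≤ k • x)
    (hne : ∀ k : ℕ, ¬ (k + 1) • x ≤ k • x) : ∃ p, IsGauge x p := by
  classical
  have hlt : ∀ c d : ℕ, c • x ≤ d • x → c ≤ d := fun c d h => by
    by_contra! hcd
    exact hne d ((nsmul_le_nsmul_left (h0 x) hcd).trans h)
  have ex : ∀ a, ∃ d, ∃ c : ℕ, a + c • x ≤ (c + d) • x := fun a => by
    obtain ⟨k, hk⟩ := hx a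
    exact ⟨k, 0, by simpa using hk⟩
  set N : A → ℕ := fun a => Nat.find (ex a)
  have spec : ∀ a, ∃ c : ℕ, a + c • x ≤ (c + N a) • x := fun a => Nat.find_spec (ex a)
  have min : ∀ a d (c : ℕ), a + c • x ≤ (c + d) • x → N a ≤ d := fun a d c h =>
    Nat.find_min' (ex a) ⟨c, h⟩
  have mono : ∀ a b, a ≤ b → N a ≤ N b := fun a b hab => by
    obtain ⟨c, hc⟩ := spec b
    exact min a _ c ((add_le_add_left hab _).trans hc)
  have sub : ∀ a b, N (a + b) ≤ N a + N b := fun a b => by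
    obtain ⟨c, hc⟩ := spec a
    obtain ⟨d, hd⟩ := spec b
    refine min _ _ (c + d) ?_
    have := add_le_add hc hd
    rwa [add_add_add_comm, ← add_nsmul, ← add_nsmul, add_add_add_comm c] at this
  have unit : ∀ a, N (a + x) = N a + 1 := fun a => by
    refine le_antisymm ?_ ?_
    · obtain ⟨c, hc⟩ := spec a
      refine min _ _ c ?_
      rw [add_right_comm, ← add_assoc, succ_nsmul]
      exact add_le_add_left hc x
    · obtain ⟨c, hc⟩ := spec (a + x)
      have h1 : a + (c + 1) • x ≤ (c + N (a + x)) • x := by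
        rwa [succ_nsmul', ← add_assoc]
      have h2 : c + 1 ≤ c + N (a + x) :=
        hlt _ _ (le_trans (by simpa using add_le_add_left (h0 a) ((c + 1) • x)) h1)
      have h3 : N a ≤ N (a + x) - 1 := min a (N (a + x) - 1) (c + 1) (by
        rwa [show c + 1 + (N (a + x) - 1) = c + N (a + x) by omega])
      omega
  have unit' : ∀ a (k : ℕ), N (a + k • x) = N a + k := fun a k => by
    induction k with
    | zero => simp
    | succ k ih => rw [succ_nsmul, ← add_assoc, unit, ih]; omega
  set s : A → ℕ → ℝ := fun a b => N (b • a) with hs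
  have hsub : ∀ a, Subadditive (s a) := fun a m n => by
    simp only [hs, add_nsmul]
    exact_mod_cast sub _ _
  have lim : ∀ a, Tendsto (fun b : ℕ => s a b / b) atTop (𝓝 (hsub a).lim) := fun a =>
    (hsub a).tendsto_lim ⟨0, by rintro _ ⟨b, rfl⟩; positivity⟩
  refine ⟨fun a => (hsub a).lim, fun a b hab => ?_, fun a b => ?_, fun k a => ?_, fun a => ?_⟩
  · refine le_of_tendsto_of_tendsto' (lim a) (lim b) fun t => ?_
    have := mono _ _ (nsmul_le_nsmul_right hab t)
    simp only [hs]
    gcongr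
  · refine le_of_tendsto_of_tendsto' (lim (a + b)) ((lim a).add (lim b)) fun t => ?_
    have : (N (t • (a + b)) : ℝ) ≤ N (t • a) + N (t • b) := by
      rw [nsmul_add]
      exact_mod_cast sub _ _
    rw [← add_div]
    simp only [hs]
    gcongr
  · rcases k.eq_zero_or_pos with rfl | hk
    · have hN0 : N 0 = 0 := Nat.le_zero.1 (min 0 0 0 (by simp))
      refine tendsto_nhds_unique (lim _) ?_
      simp [hs, hN0]
    · have h1 : Tendsto (fun t : ℕ => (k : ℝ) * (s a (k * t) / (k * t : ℕ))) atTop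
          (𝓝 (k * (hsub a).lim)) :=
        ((lim a).comp (tendsto_id.const_mul_atTop' hk)).const_mul _
      refine tendsto_nhds_unique (lim _) (h1.congr fun t => ?_)
      have hk' : (k : ℝ) ≠ 0 := by positivity
      simp only [hs]
      rw [mul_nsmul]
      push_cast
      rw [mul_div_assoc', mul_div_mul_left _ _ hk']
  · refine tendsto_nhds_unique (lim _) (((lim a).add tendsto_const_nhds).congr' ?_)
    filter_upwards [eventually_gt_atTop 0] with t ht
    have ht' : (t : ℝ) ≠ 0 := by positivity
    simp only [hs, nsmul_add, unit']
    push_cast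
    field_simp

end IsGauge

/-- Tarski's extension theorem: a preordered commutative monoid with an order unit `x`, no multiple
`(k + 1) • x` of which lies below `k • x`, carries a monotone additive functional with value `1` at
`x`. -/
theorem exists_state [IsOrderedAddMonoid A] {x : A} (h0 : ∀ a : A, 0 ≤ a)
    (hx : ∀ a, ∃ k : ℕ, a ≤ k • x) (hne : ∀ k : ℕ, ¬ (k + 1) • x ≤ k • x) :
    ∃ ν : A → ℝ, ν 0 = 0 ∧ (∀ a b, ν (a + b) = ν a + ν b) ∧ Monotone ν ∧ ν x = 1 := by
  obtain ⟨p₀, hp₀⟩ := IsGauge.exists_of_not_le h0 hx hne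
  obtain ⟨p, -, hp⟩ := zorn_le_nonempty₀ (α := (A → ℝ)ᵒᵈ) {p | IsGauge x (OrderDual.ofDual p)}
    (fun C hC hchain q hq =>
      ⟨OrderDual.toDual fun a => ⨅ q : C, OrderDual.ofDual (q : (A → ℝ)ᵒᵈ) a,
        IsGauge.sInf_chain h0 hC hchain.symm ⟨q, hq⟩, fun r hr a =>
          ciInf_le (f := fun q : C => OrderDual.ofDual (q : (A → ℝ)ᵒᵈ) a)
            ⟨0, by rintro _ ⟨q, rfl⟩; exact IsGauge.nonneg h0 (hC q.2) a⟩ ⟨r, hr⟩⟩)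
    (OrderDual.toDual p₀) hp₀
  have hg : IsGauge x (OrderDual.ofDual p) := hp.1
  refine ⟨OrderDual.ofDual p, hg.map_zero, fun a b => le_antisymm (hg.add_le a b) ?_, hg.mono, ?_⟩
  · obtain ⟨q, hq, hqp, hqb⟩ := hg.exists_le_sub h0 b
    have h1 : OrderDual.ofDual p a ≤ q a := hp.2 (y := OrderDual.toDual q) hq hqp a
    linarith [hqb a]
  · simpa [hg.map_zero] using hg.add_unit 0

/-- `exists_state` for a submonoid whose preorder is given by a relation on the whole monoid. -/
lemma exists_state_of_rel {M : Type*} [AddCommMonoid M] (B : AddSubmonoid M) {r : M → M → Prop}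
    (refl : ∀ a ∈ B, r a a) (trans : ∀ a b c, r a b → r b c → r a c)
    (add : ∀ a b c d, r a b → r c d → r (a + c) (b + d)) (zero : ∀ a, r 0 a) {x : M} (hx : x ∈ B)
    (unit : ∀ a ∈ B, ∃ k : ℕ, r a (k • x)) (hne : ∀ k : ℕ, ¬ r ((k + 1) • x) (k • x)) :
    ∃ ν : M → ℝ, ν 0 = 0 ∧ (∀ a ∈ B, ∀ b ∈ B, ν (a + b) = ν a + ν b) ∧
      (∀ a ∈ B, ∀ b ∈ B, r a b → ν a ≤ ν b) ∧ ν x = 1 := by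
  classical
  let _ : Preorder B :=
    { le := fun a b => r a b
      le_refl := fun a => refl a a.2
      le_trans := fun a b c => trans a b c }
  have : IsOrderedAddMonoid B :=
    { add_le_add_left := fun a b h c => add a b c c h (refl c c.2) }
  obtain ⟨ν, ν0, νadd, νmono, νx⟩ := exists_state (x := (⟨x, hx⟩ : B)) (fun a => zero a)
    (fun a => unit a a.2) hne
  refine ⟨fun a => if h : a ∈ B then ν ⟨a, h⟩ else 0, ?_, fun a ha b hb => ?_,
    fun a ha b hb h => ?_, ?_⟩
  · dsimp only
    rw [dif_pos B.zero_mem]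
    exact ν0
  · dsimp only
    rw [dif_pos ha, dif_pos hb, dif_pos (B.add_mem ha hb)]
    exact νadd ⟨a, ha⟩ ⟨b, hb⟩
  · dsimp only
    rw [dif_pos ha, dif_pos hb]
    exact νmono (show (⟨a, ha⟩ : B) ≤ ⟨b, hb⟩ from h)
  · dsimp only
    rw [dif_pos hx]
    exact νx

end States

/-! ### Counting functions and piecewise translation -/

section Counting

variable {L : FirstOrder.Language.{u, v}} {S : Type w} [L.Structure S] {n : ℕ}

lemma sum_indicator_apply {V T : Type*} [Fintype T] (A : T → Set V) (y : V) :
    (∑ t, (A t).indicator (1 : V → ℕ)) y = {t | y ∈ A t}.ncard := by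
  classical
  simp [Finset.sum_apply, Set.indicator_apply, Finset.sum_boole, Set.ncard_eq_toFinset_card']

lemma eq_of_sum_indicator_le {V T : Type*} [Fintype T] {A : T → Set V} {B : Set V}
    (h : ∑ t, (A t).indicator (1 : V → ℕ) ≤ B.indicator 1) {y : V} {t t' : T} (ht : y ∈ A t)
    (ht' : y ∈ A t') : t = t' := by
  have h1 := h y
  rw [sum_indicator_apply] at h1
  refine (Set.ncard_le_one_iff (Set.toFinite {t | y ∈ A t})).1 (h1.trans ?_) ht ht'
  exact Set.indicator_apply_le' (fun _ => le_rfl) (fun _ => zero_le_one)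

lemma subset_of_sum_indicator_le {V T : Type*} [Fintype T] {A : T → Set V} {B : Set V}
    (h : ∑ t, (A t).indicator (1 : V → ℕ) ≤ B.indicator 1) (t : T) : A t ⊆ B := by
  intro y hy
  by_contra hB
  have h1 := h y
  rw [sum_indicator_apply, Set.indicator_of_notMem hB, Nat.le_zero,
    Set.ncard_eq_zero (Set.toFinite _)] at h1
  exact Set.eq_empty_iff_forall_notMem.1 h1 t hy

lemma exists_mem_of_sum_indicator_eq {V T : Type*} [Fintype T] {A : T → Set V} {B : Set V}
    (h : ∑ t, (A t).indicator (1 : V → ℕ) = B.indicator 1) {y : V} (hy : y ∈ B) :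
    ∃ t, y ∈ A t := by
  by_contra! ht
  have h1 := congrFun h y
  rw [sum_indicator_apply, Set.indicator_of_mem hy] at h1
  simp [ht] at h1

lemma indicator_image_perm {V : Type*} (g : Equiv.Perm V) (C : Set V) (y : V) :
    (g '' C).indicator (1 : V → ℕ) y = C.indicator 1 (g.symm y) := by
  classical
  simp [Set.indicator_apply, Equiv.image_eq_preimage_symm]

lemma definable_image {I : Subgroup (Equiv.Perm (Fin n → S))} (hI : IsIsomorphismGroup L I)
    {f : Equiv.Perm (Fin n → S)} (hf : f ∈ I) {P : Set (Fin n → S)}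
    (hP : (Set.univ : Set S).Definable L P) : (Set.univ : Set S).Definable L (f '' P) := by
  rw [Equiv.image_eq_preimage_symm]
  exact Set.Definable.preimage_map (hI f⁻¹ (I.inv_mem hf)) hP

/-- A condition on which members of a finite family of definable sets a point belongs to is
definable. -/
lemma definable_pattern {T : Type} [Finite T] {A : T → Set (Fin n → S)}
    (hA : ∀ t, (Set.univ : Set S).Definable L (A t)) (Q : Set T → Prop) :
    (Set.univ : Set S).Definable L {y | Q {t | y ∈ A t}} := by
  classical
  have h : {y | Q {t | y ∈ A t}} =
      ⋃ s : {s : Set T // Q s}, ⋂ t, if t ∈ s.1 then A t else (A t)ᶜ := by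
    ext y
    simp only [Set.mem_ofPred_eq, Set.mem_iUnion, Set.mem_iInter]
    refine ⟨fun hy => ⟨⟨_, hy⟩, fun t => ?_⟩, fun ⟨s, hs⟩ => ?_⟩
    · by_cases ht : y ∈ A t <;> simp [ht]
    · convert s.2 using 1
      ext t
      have := hs t
      by_cases ht : t ∈ s.1 <;> simp_all
  rw [h]
  refine Set.definable_iUnion_of_finite fun s => Set.definable_iInter_of_finite fun t => ?_
  split_ifs
  exacts [hA t, (hA t).compl]

/-- If a finite family of definable sets covers each point at most as often as another one, then
its members split into definable pieces which, regrouped, fit disjointly into the members of the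
other family. Which member receives a point is decided by an injection depending only on the
members of the two families that contain the point, so the pieces are definable. -/
lemma exists_splitting {T U : Type} [Fintype T] [Fintype U]
    {A : T → Set (Fin n → S)} {B : U → Set (Fin n → S)}
    (hA : ∀ t, (Set.univ : Set S).Definable L (A t))
    (hB : ∀ t, (Set.univ : Set S).Definable L (B t))
    (h : ∑ t, (A t).indicator (1 : (Fin n → S) → ℕ) ≤ ∑ t, (B t).indicator 1) :
    ∃ C : T → U → Set (Fin n → S), (∀ t u, (Set.univ : Set S).Definable L (C t u)) ∧
      (∀ t, ∑ u, (C t u).indicator (1 : (Fin n → S) → ℕ) = (A t).indicator 1) ∧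
      ∀ u, ∑ t, (C t u).indicator (1 : (Fin n → S) → ℕ) ≤ (B u).indicator 1 := by
  classical
  have key : ∀ (s : Set T) (s' : Set U), ∃ ρ : T → U → Prop, s.ncard ≤ s'.ncard →
      (∀ t u, ρ t u → t ∈ s ∧ u ∈ s') ∧ (∀ t ∈ s, ∃ u, ∀ u', ρ t u' ↔ u' = u) ∧
      ∀ u t t', ρ t u → ρ t' u → t = t' := fun s s' => by
    by_cases hc : s.ncard ≤ s'.ncard
    · have hc' : Fintype.card s ≤ Fintype.card s' := by
        rwa [Set.ncard_eq_toFinset_card', Set.ncard_eq_toFinset_card', Set.toFinset_card,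
          Set.toFinset_card] at hc
      obtain ⟨e⟩ := Function.Embedding.nonempty_of_card_le hc'
      refine ⟨fun t u => ∃ ht : t ∈ s, (e ⟨t, ht⟩ : U) = u, fun _ => ⟨?_, ?_, ?_⟩⟩
      · rintro t _ ⟨ht, rfl⟩
        exact ⟨ht, (e _).2⟩
      · exact fun t ht => ⟨e ⟨t, ht⟩, fun u' => ⟨fun ⟨_, h⟩ => h.symm, fun h => ⟨ht, h.symm⟩⟩⟩
      · rintro u t t' ⟨ht, h1⟩ ⟨ht', h2⟩
        exact congrArg Subtype.val (e.injective (Subtype.ext (h1.trans h2.symm)))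
    · exact ⟨fun _ _ => False, fun h => absurd h hc⟩
  choose ρ hρ using key
  have hle : ∀ y, {t | y ∈ A t}.ncard ≤ {u | y ∈ B u}.ncard := fun y => by
    simpa only [sum_indicator_apply] using h y
  refine ⟨fun t u => {y | ρ {t | y ∈ A t} {u | y ∈ B u} t u}, fun t u => ?_, fun t => ?_,
    fun u => ?_⟩
  · exact definable_pattern (A := Sum.elim A B) (Sum.forall.2 ⟨hA, hB⟩)
      fun s => ρ {t | Sum.inl t ∈ s} {u | Sum.inr u ∈ s} t u
  · funext y
    obtain ⟨h1, h2, -⟩ := hρ _ _ (hle y)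
    rw [sum_indicator_apply, Set.indicator_apply]
    split_ifs with hy
    · obtain ⟨u, hu⟩ := h2 t hy
      exact Set.ncard_eq_one.2 ⟨u, Set.ext fun u' => hu u'⟩
    · exact (Set.ncard_eq_zero).2 (Set.eq_empty_of_forall_notMem fun u hu => hy (h1 _ _ hu).1)
  · intro y
    obtain ⟨h1, -, h3⟩ := hρ _ _ (hle y)
    rw [sum_indicator_apply, Set.indicator_apply]
    split_ifs with hy
    · exact (Set.ncard_le_one_iff (Set.toFinite _)).2 fun ht ht' => h3 u _ _ ht ht'
    · exact ((Set.ncard_eq_zero).2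
        (Set.eq_empty_of_forall_notMem fun t ht => hy (h1 _ _ ht).2)).le

variable (L) in
/-- The counting form of `Embeds`. A subset of a disjoint union of copies of `Sⁿ` is replaced by the
function counting how often it covers each point of `Sⁿ`: here `α` is a sum of indicator functions
of definable sets, and the sum of the indicators of suitable isomorphic images of these sets is at
most `β`. -/
def CountEmbeds (I : Subgroup (Equiv.Perm (Fin n → S))) (α β : (Fin n → S) → ℕ) : Prop :=
  ∃ (r : ℕ) (P : Fin r → Set (Fin n → S)) (f : Fin r → Equiv.Perm (Fin n → S)),
    (∀ t, (Set.univ : Set S).Definable L (P t)) ∧ (∀ t, f t ∈ I) ∧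
    ∑ t, (P t).indicator 1 = α ∧ ∑ t, (f t '' P t).indicator 1 ≤ β

namespace CountEmbeds

variable {I : Subgroup (Equiv.Perm (Fin n → S))} {α β γ α' β' : (Fin n → S) → ℕ}

lemma of_fintype {T : Type} [Fintype T] (P : T → Set (Fin n → S))
    (f : T → Equiv.Perm (Fin n → S)) (hP : ∀ t, (Set.univ : Set S).Definable L (P t))
    (hf : ∀ t, f t ∈ I) (hα : ∑ t, (P t).indicator 1 = α)
    (hβ : ∑ t, (f t '' P t).indicator 1 ≤ β) : CountEmbeds L I α β := by
  let e := (Fintype.equivFin T).symm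
  refine ⟨_, P ∘ e, f ∘ e, fun t => hP _, fun t => hf _, ?_, ?_⟩
  · rw [← hα]
    exact e.sum_comp fun t => (P t).indicator 1
  · refine le_of_eq_of_le ?_ hβ
    exact e.sum_comp fun t => (f t '' P t).indicator (1 : (Fin n → S) → ℕ)

lemma of_image {f : Equiv.Perm (Fin n → S)} (hf : f ∈ I) {P : Set (Fin n → S)}
    (hP : (Set.univ : Set S).Definable L P) :
    CountEmbeds L I (P.indicator 1) ((f '' P).indicator 1) :=
  of_fintype (T := Unit) (fun _ => P) (fun _ => f) (fun _ => hP) (fun _ => hf) (by simp) (by simp)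

lemma zero_left (β : (Fin n → S) → ℕ) : CountEmbeds L I 0 β :=
  ⟨0, fun _ => ∅, fun _ => 1, fun t => t.elim0, fun t => t.elim0, by simp, by simp⟩

/-- `CountEmbeds` is reflexive on sums of indicators of definable sets. -/
lemma refl_left (h : CountEmbeds L I α β) : CountEmbeds L I α α := by
  obtain ⟨r, P, f, hP, -, hα, -⟩ := h
  exact ⟨r, P, fun _ => 1, hP, fun _ => I.one_mem, hα, by simp [hα]⟩

lemma mono_right (h : CountEmbeds L I α β) (hβ : β ≤ γ) : CountEmbeds L I α γ := by
  obtain ⟨r, P, f, hP, hf, hα, hβ'⟩ := h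
  exact ⟨r, P, f, hP, hf, hα, hβ'.trans hβ⟩

lemma add (h : CountEmbeds L I α β) (h' : CountEmbeds L I α' β') :
    CountEmbeds L I (α + α') (β + β') := by
  obtain ⟨r, P, f, hP, hf, rfl, hβ⟩ := h
  obtain ⟨r', P', f', hP', hf', rfl, hβ'⟩ := h'
  refine of_fintype (Sum.elim P P') (Sum.elim f f') (Sum.forall.2 ⟨hP, hP'⟩)
    (Sum.forall.2 ⟨hf, hf'⟩) (by simp [Fintype.sum_sum_type]) ?_
  simpa [Fintype.sum_sum_type] using add_le_add hβ hβ'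

lemma trans (hI : IsIsomorphismGroup L I) (h : CountEmbeds L I α β) (h' : CountEmbeds L I β γ) :
    CountEmbeds L I α γ := by
  obtain ⟨r, P, f, hP, hf, rfl, hβ⟩ := h
  obtain ⟨r', Q, g, hQ, hg, rfl, hγ⟩ := h'
  obtain ⟨C, hC, hC1, hC2⟩ := exists_splitting (fun t => definable_image hI (hf t) (hP t)) hQ hβ
  refine of_fintype (T := Fin r × Fin r') (fun z => ⇑(f z.1)⁻¹ '' C z.1 z.2)
    (fun z => g z.2 * f z.1) (fun z => definable_image hI (I.inv_mem (hf z.1)) (hC _ _))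
    (fun z => I.mul_mem (hg _) (hf _)) ?_ (le_trans ?_ hγ)
  · rw [Fintype.sum_prod_type]
    refine Finset.sum_congr rfl fun t _ => funext fun y => ?_
    have := congrFun (hC1 t) (f t y)
    rw [indicator_image_perm, Equiv.symm_apply_apply] at this
    rw [← this, Finset.sum_apply, Finset.sum_apply]
    exact Finset.sum_congr rfl fun s _ => indicator_image_perm _ _ _
  · rw [Fintype.sum_prod_type_right]
    refine Finset.sum_le_sum fun s _ y => ?_
    have := hC2 s ((g s).symm y)
    rw [Finset.sum_apply] at this
    rw [indicator_image_perm, Finset.sum_apply]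
    refine le_of_eq_of_le (Finset.sum_congr rfl fun t _ => ?_) this
    rw [← indicator_image_perm, ← Set.image_comp]
    congr 2
    ext z
    simp

/-- The counting form of `Embeds` implies `Embeds` itself: the pieces of the source are distributed
over its levels, and their images over the levels of the target. -/
lemma embeds (hI : IsIsomorphismGroup L I) {ι κ : Type} [Fintype ι] [Fintype κ]
    {Y : Set (ι × (Fin n → S))} {Z : Set (κ × (Fin n → S))} (hY : IsDefinable L Y)
    (hZ : IsDefinable L Z)
    (h : CountEmbeds L I (∑ i, {x | (i, x) ∈ Y}.indicator 1) (∑ j, {x | (j, x) ∈ Z}.indicator 1)) :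
    Embeds L I Y Z := by
  obtain ⟨r, P, f, hP, hf, hα, hβ⟩ := h
  obtain ⟨C, hC, hC1, hC2⟩ := exists_splitting hP hY hα.le
  -- both sides have the same total, so the inequalities `hC2` are equalities
  have hC3 : ∀ i, ∑ t, (C t i).indicator (1 : (Fin n → S) → ℕ) =
      {x | (i, x) ∈ Y}.indicator 1 := fun i => by
    refine (Finset.sum_eq_sum_iff_of_le fun i _ => hC2 i).1 ?_ i (Finset.mem_univ i)
    rw [← hα, Finset.sum_comm]
    exact Finset.sum_congr rfl fun t _ => hC1 t
  obtain ⟨D, hD, hD1, hD2⟩ := exists_splitting (T := Fin r × ι)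
    (A := fun z => f z.1 '' C z.1 z.2) (fun z => definable_image hI (hf _) (hC _ _)) hZ (by
      refine le_of_eq_of_le ?_ hβ
      rw [Fintype.sum_prod_type]
      refine Finset.sum_congr rfl fun t _ => funext fun y => ?_
      rw [indicator_image_perm, ← hC1, Finset.sum_apply, Finset.sum_apply]
      exact Finset.sum_congr rfl fun i _ => indicator_image_perm _ _ _)
  have ofD : ∀ t i j x, f t x ∈ D (t, i) j → x ∈ C t i := fun t i j x hx => by
    simpa using subset_of_sum_indicator_le (hD1 (t, i)).le j hx
  have mem_img : ∀ t (E : Set (Fin n → S)) y, y ∈ f t '' (f t ⁻¹' E) ↔ y ∈ E := fun t E y => by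
    rw [Set.image_preimage_eq _ (f t).surjective]
  let e := (Fintype.equivFin ((Fin r × ι) × κ)).symm
  refine ⟨_, fun s => (e s).1.2, fun s => (e s).2, fun s => f (e s).1.1 ⁻¹' D (e s).1 (e s).2,
    fun s => f (e s).1.1, fun s => Set.Definable.preimage_map (hI _ (hf _)) (hD _ _),
    fun s => hf _, fun s s' hs => Set.disjoint_left.2 ?_, ?_,
    fun s s' hs => Set.disjoint_left.2 ?_, ?_⟩
  · rintro ⟨i, x⟩ ⟨h1, h2⟩ ⟨h3, h4⟩
    refine hs (e.injective ?_)
    revert h1 h2 h3 h4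
    dsimp only
    generalize e s = z
    generalize e s' = z'
    obtain ⟨⟨t, k⟩, j⟩ := z
    obtain ⟨⟨t', k'⟩, j'⟩ := z'
    rintro rfl h2 rfl h4
    obtain rfl := eq_of_sum_indicator_le (hC2 _) (ofD _ _ _ _ h2) (ofD _ _ _ _ h4)
    obtain rfl := eq_of_sum_indicator_le (hD1 _).le h2 h4
    rfl
  · ext ⟨i, x⟩
    rw [Set.mem_iUnion]
    constructor
    · rintro ⟨s, h1, h2⟩
      obtain rfl : i = (e s).1.2 := h1
      exact subset_of_sum_indicator_le (hC2 _) _ (ofD _ _ _ _ h2)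
    · intro hx
      obtain ⟨t, ht⟩ := exists_mem_of_sum_indicator_eq (hC3 i) hx
      obtain ⟨j, hj⟩ := exists_mem_of_sum_indicator_eq (hD1 (t, i)) (Set.mem_image_of_mem _ ht)
      exact ⟨e.symm ((t, i), j), by simpa using hj⟩
  · rintro ⟨j, y⟩ ⟨h1, h2⟩ ⟨h3, h4⟩
    obtain rfl : j = (e s).2 := h1
    have h3' : (e s).2 = (e s').2 := h3
    have h4' := (mem_img _ _ _).1 h4
    rw [← h3'] at h4'
    exact hs (e.injective (Prod.ext
      (eq_of_sum_indicator_le (hD2 _) ((mem_img _ _ _).1 h2) h4') h3'))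
  · refine Set.iUnion_subset ?_
    rintro s ⟨j, y⟩ ⟨h1, h2⟩
    obtain rfl : j = (e s).2 := h1
    exact subset_of_sum_indicator_le (hD2 (e s).2) _ ((mem_img _ _ _).1 h2)

end CountEmbeds

end Counting

/-! ### From states to measures -/

section Measure

variable {L : FirstOrder.Language.{u, v}} {S : Type w} [L.Structure S] {n : ℕ}
  {I : Subgroup (Equiv.Perm (Fin n → S))}

variable (L I) in
/-- The functions `Sⁿ → ℕ` that, in the sense of `CountEmbeds`, are contained in finitely many
copies of `X`. By the definition of `CountEmbeds`, they are sums of indicators of definable sets. -/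
def boundedCounts (X : Set (Fin n → S)) : AddSubmonoid ((Fin n → S) → ℕ) where
  carrier := {α | ∃ k : ℕ, CountEmbeds L I α (k • X.indicator 1)}
  zero_mem' := ⟨0, .zero_left _⟩
  add_mem' := by
    rintro α β ⟨k, hk⟩ ⟨l, hl⟩
    exact ⟨k + l, by simpa only [add_nsmul] using hk.add hl⟩

/-- If no `(k + 1) X` embeds into `k X`, then there is an invariant measure normalised at `X`. It is
given by a state on the bounded counting functions, and is infinite on all other sets. -/
lemma exists_measure (hI : IsIsomorphismGroup L I) (X : L.DefinableSet (Set.univ : Set S) (Fin n))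
    (hX : ∀ k : ℕ, ¬ CountEmbeds L I ((k + 1) • (X : Set (Fin n → S)).indicator 1)
      (k • (X : Set (Fin n → S)).indicator 1)) :
    ∃ μ : L.DefinableSet (Set.univ : Set S) (Fin n) → ℝ≥0∞, IsInvariantMeasure L I μ ∧ μ X = 1 := by
  classical
  set B := boundedCounts L I (X : Set (Fin n → S))
  have refl : ∀ Y : L.DefinableSet (Set.univ : Set S) (Fin n),
      CountEmbeds L I ((Y : Set (Fin n → S)).indicator 1) ((Y : Set (Fin n → S)).indicator 1) :=
    fun Y => (CountEmbeds.of_image I.one_mem Y.2).refl_left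
  have hXB : (X : Set (Fin n → S)).indicator 1 ∈ B := ⟨1, by simpa using refl X⟩
  obtain ⟨ν, ν0, νadd, νmono, νX⟩ := exists_state_of_rel B (r := CountEmbeds L I)
    (fun _ h => h.choose_spec.refl_left) (fun _ _ _ => CountEmbeds.trans hI)
    (fun _ _ _ _ => CountEmbeds.add) CountEmbeds.zero_left hXB (fun _ h => h) hX
  have νnonneg : ∀ α ∈ B, 0 ≤ ν α := fun α h =>
    ν0 ▸ νmono 0 B.zero_mem α h (CountEmbeds.zero_left _)
  have memB : ∀ Y Z : L.DefinableSet (Set.univ : Set S) (Fin n),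
      CountEmbeds L I ((Y : Set (Fin n → S)).indicator 1) ((Z : Set (Fin n → S)).indicator 1) →
      (Z : Set (Fin n → S)).indicator 1 ∈ B → (Y : Set (Fin n → S)).indicator 1 ∈ B :=
    fun Y Z h ⟨k, hk⟩ => ⟨k, h.trans hI hk⟩
  refine ⟨fun Y => if (Y : Set (Fin n → S)).indicator 1 ∈ B then
    ENNReal.ofReal (ν ((Y : Set (Fin n → S)).indicator 1)) else ⊤,
    ⟨?_, fun Y Z hYZ => ?_, fun f hf Y Z hZ => ?_⟩, ?_⟩
  · rw [FirstOrder.Language.DefinableSet.coe_bot, Set.indicator_empty', if_pos, ν0,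
      ENNReal.ofReal_zero]
    exact B.zero_mem
  · have hadd : ((Y ⊔ Z : L.DefinableSet (Set.univ : Set S) (Fin n)) : Set (Fin n → S)).indicator
        (1 : (Fin n → S) → ℕ) =
        (Y : Set (Fin n → S)).indicator 1 + (Z : Set (Fin n → S)).indicator 1 := by
      rw [FirstOrder.Language.DefinableSet.coe_sup, Set.indicator_union_of_disjoint hYZ]
      rfl
    by_cases hU : ((Y ⊔ Z : L.DefinableSet (Set.univ : Set S) (Fin n)) :
        Set (Fin n → S)).indicator (1 : (Fin n → S) → ℕ) ∈ B
    · have hY := memB Y (Y ⊔ Z) ((refl Y).mono_right (hadd ▸ le_add_of_nonneg_right zero_le)) hU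
      have hZ := memB Z (Y ⊔ Z) ((refl Z).mono_right (hadd ▸ le_add_of_nonneg_left zero_le)) hU
      rw [if_pos hU, if_pos hY, if_pos hZ, hadd, νadd _ hY _ hZ,
        ENNReal.ofReal_add (νnonneg _ hY) (νnonneg _ hZ)]
    · rw [if_neg hU]
      by_cases hY : (Y : Set (Fin n → S)).indicator (1 : (Fin n → S) → ℕ) ∈ B
      · have hZ : (Z : Set (Fin n → S)).indicator (1 : (Fin n → S) → ℕ) ∉ B := fun hZ =>
          hU (hadd ▸ B.add_mem hY hZ)
        rw [if_neg hZ, add_top]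
      · rw [if_neg hY, top_add]
  · have h1 : CountEmbeds L I ((Y : Set (Fin n → S)).indicator 1)
        ((Z : Set (Fin n → S)).indicator 1) := hZ ▸ CountEmbeds.of_image hf Y.2
    have h2 : CountEmbeds L I ((Z : Set (Fin n → S)).indicator 1)
        ((Y : Set (Fin n → S)).indicator 1) := by
      have h3 : ⇑f⁻¹ '' (Z : Set (Fin n → S)) = Y := by
        rw [hZ, ← Set.image_comp]
        simp
      exact h3 ▸ CountEmbeds.of_image (I.inv_mem hf) Z.2
    by_cases hY : (Y : Set (Fin n → S)).indicator (1 : (Fin n → S) → ℕ) ∈ B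
    · have hZ := memB Z Y h2 hY
      rw [if_pos hY, if_pos hZ]
      exact congrArg _ (le_antisymm (νmono _ hZ _ hY h2) (νmono _ hY _ hZ h1))
    · have hZ : (Z : Set (Fin n → S)).indicator (1 : (Fin n → S) → ℕ) ∉ B := fun h =>
        hY (memB Y Z h1 h)
      rw [if_neg hY, if_neg hZ]
  · dsimp only
    rw [if_pos hXB, νX, ENNReal.ofReal_one]

end Measure

/-! ### Paradoxical multiples -/

section Paradox

variable {L : FirstOrder.Language.{u, v}} {S : Type w} [L.Structure S] {n : ℕ}
  {I : Subgroup (Equiv.Perm (Fin n → S))}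

/-- Once `(k + 1) X` embeds into `k X`, every multiple of `X` does. -/
lemma CountEmbeds.nsmul_of_succ (hI : IsIsomorphismGroup L I) {α : (Fin n → S) → ℕ} {k : ℕ}
    (h : CountEmbeds L I ((k + 1) • α) (k • α)) (hα : CountEmbeds L I α α) (N : ℕ) :
    CountEmbeds L I (N • α) (k • α) := by
  have hN : ∀ N : ℕ, CountEmbeds L I (N • α) (N • α) := fun N => by
    induction N with
    | zero => simpa using CountEmbeds.zero_left (L := L) (I := I) 0
    | succ N ih => simpa only [succ_nsmul] using ih.add hα
  induction N with
  | zero => simpa using CountEmbeds.zero_left (L := L) (I := I) (k • α)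
  | succ N ih =>
    rw [succ_nsmul]
    exact (ih.add hα).trans hI (by simpa only [succ_nsmul] using h)

lemma isDefinable_single (X : L.DefinableSet (Set.univ : Set S) (Fin n)) :
    IsDefinable L (single L X) := fun _ => X.2

lemma IsDefinable.copies {ι : Type} {Y : Set (ι × (Fin n → S))} (hY : IsDefinable L Y) (k : ℕ) :
    IsDefinable L (copies k Y) := fun i => hY i.2

lemma count_copies {ι V : Type*} [Fintype ι] (k : ℕ) (Y : Set (ι × V)) :
    ∑ i : Fin k × ι, {x | (i.2, x) ∈ Y}.indicator (1 : V → ℕ) =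
      k • ∑ i, {x | (i, x) ∈ Y}.indicator 1 := by
  rw [Fintype.sum_prod_type]
  simp

/-- If `(k + 1) X` embeds into `k X`, then `2 X` is itself small enough, for every `m`, to be the
exceptional set `Y₀` in the definition of an almost embedding of `2 X`; what is left to embed into
`X` is the empty set. -/
lemma almostEmbeds_of_countEmbeds (hI : IsIsomorphismGroup L I)
    (X : L.DefinableSet (Set.univ : Set S) (Fin n)) {k : ℕ}
    (h : CountEmbeds L I ((k + 1) • (X : Set (Fin n → S)).indicator 1)
      (k • (X : Set (Fin n → S)).indicator 1)) :
    AlmostEmbeds L I (copies 2 (single L X)) (single L X) := by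
  intro m hm
  set α : (Fin n → S) → ℕ := (X : Set (Fin n → S)).indicator 1 with hα
  have hrefl : CountEmbeds L I α α := (CountEmbeds.of_image I.one_mem X.2).refl_left
  have hdef : IsDefinable L (copies 2 (single L X)) := (isDefinable_single X).copies 2
  have hcount : ∀ p : ℕ, ∑ i : Fin p × Fin 2 × Unit,
      {x | (i, x) ∈ copies p (copies 2 (single L X))}.indicator (1 : (Fin n → S) → ℕ) =
      (p * 2) • α := fun p => by
    refine (count_copies p (copies 2 (single L X))).trans ?_
    rw [mul_nsmul']
    congr 1
    refine (count_copies 2 (single L X)).trans ?_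
    simp [single, hα]
  refine ⟨_, subset_rfl, hdef, ⟨m * (k + 1), k + 1, by positivity, by positivity, ?_, ?_⟩, ?_⟩
  -- `k + 1` rather than `k`, which may be `0`, serves as the denominator
  · rw [le_div_iff₀ (by positivity)]
    push_cast
    rfl
  · refine CountEmbeds.embeds hI (hdef.copies _) (hdef.copies _) ?_
    rw [hcount, hcount]
    refine (h.nsmul_of_succ hI hrefl _).mono_right ?_
    exact nsmul_le_nsmul_left zero_le (by omega)
  · rw [Set.sdiff_self]
    exact ⟨0, fun i => i.elim0, fun i => i.elim0, fun _ => ∅, fun _ => 1, fun i => i.elim0,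
      fun i => i.elim0, fun i => i.elim0, by simp, fun i => i.elim0, by simp⟩

end Paradox

/-! ### Measures obstruct almost embeddings -/

section Obstruction

variable {L : FirstOrder.Language.{u, v}} {S : Type w} [L.Structure S] {n : ℕ}
  {I : Subgroup (Equiv.Perm (Fin n → S))}
  {μ : L.DefinableSet (Set.univ : Set S) (Fin n) → ℝ≥0∞}

open Classical in
/-- The extension by `0` of a function on definable sets to all subsets of `Sⁿ`. -/
noncomputable def extend (μ : L.DefinableSet (Set.univ : Set S) (Fin n) → ℝ≥0∞)
    (P : Set (Fin n → S)) : ℝ≥0∞ :=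
  if h : (Set.univ : Set S).Definable L P then μ ⟨P, h⟩ else 0

/-- The total measure of a subset of a finite disjoint union of copies of `Sⁿ`. -/
noncomputable def total (μ : L.DefinableSet (Set.univ : Set S) (Fin n) → ℝ≥0∞) {ι : Type}
    [Fintype ι] (Y : Set (ι × (Fin n → S))) : ℝ≥0∞ :=
  ∑ i, extend μ {x | (i, x) ∈ Y}

lemma extend_coe (X : L.DefinableSet (Set.univ : Set S) (Fin n)) :
    extend μ (X : Set (Fin n → S)) = μ X :=
  dif_pos X.2

lemma total_copies {ι : Type} [Fintype ι] (k : ℕ) (Y : Set (ι × (Fin n → S))) :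
    total μ (copies k Y) = k * total μ Y := by
  simp only [total, Fintype.sum_prod_type, copies]
  simp

lemma total_single (X : L.DefinableSet (Set.univ : Set S) (Fin n)) :
    total μ (single L X) = μ X := by
  rw [← extend_coe (μ := μ) X]
  simp [total, single]

namespace IsInvariantMeasure

lemma extend_union (hμ : IsInvariantMeasure L I μ) {P Q : Set (Fin n → S)}
    (hP : (Set.univ : Set S).Definable L P) (hQ : (Set.univ : Set S).Definable L Q)
    (h : Disjoint P Q) : extend μ (P ∪ Q) = extend μ P + extend μ Q := by
  rw [extend, extend, extend, dif_pos hP, dif_pos hQ, dif_pos (hP.union hQ)]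
  exact hμ.additive ⟨P, hP⟩ ⟨Q, hQ⟩ h

lemma extend_mono (hμ : IsInvariantMeasure L I μ) {P Q : Set (Fin n → S)}
    (hP : (Set.univ : Set S).Definable L P) (hQ : (Set.univ : Set S).Definable L Q)
    (h : P ⊆ Q) : extend μ P ≤ extend μ Q := by
  rw [← Set.union_sdiff_cancel h, hμ.extend_union hP (hQ.sdiff hP) Set.disjoint_sdiff_right]
  exact le_self_add

lemma extend_image (hμ : IsInvariantMeasure L I μ) (hI : IsIsomorphismGroup L I)
    {f : Equiv.Perm (Fin n → S)} (hf : f ∈ I) {P : Set (Fin n → S)}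
    (hP : (Set.univ : Set S).Definable L P) : extend μ (f '' P) = extend μ P := by
  rw [extend, extend, dif_pos hP, dif_pos (definable_image hI hf hP)]
  exact hμ.invariant f hf ⟨P, hP⟩ ⟨_, definable_image hI hf hP⟩ rfl

lemma extend_biUnion (hμ : IsInvariantMeasure L I μ) {T : Type} {P : T → Set (Fin n → S)}
    (hP : ∀ t, (Set.univ : Set S).Definable L (P t)) (s : Finset T)
    (hd : (s : Set T).PairwiseDisjoint P) :
    extend μ (⋃ t ∈ s, P t) = ∑ t ∈ s, extend μ (P t) := by
  classical
  induction s using Finset.induction_on with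
  | empty =>
    have h := hμ.empty
    rw [← extend_coe (μ := μ), FirstOrder.Language.DefinableSet.coe_bot] at h
    simpa using h
  | insert a s ha ih =>
    rw [Finset.set_biUnion_insert, Finset.sum_insert ha, hμ.extend_union (hP a)
      (Set.definable_biUnion_finset hP s), ih (hd.subset (by simp))]
    rw [Set.disjoint_iUnion₂_right]
    exact fun t ht => hd (by simp) (by simp [ht]) fun h => ha (h ▸ ht)

/-- The total measure of a set cut into pieces, each of which lies in one copy of `Sⁿ`. -/
lemma total_iUnion (hμ : IsInvariantMeasure L I μ) {ι T : Type} [Fintype ι] [Fintype T]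
    {a : T → ι} {P : T → Set (Fin n → S)} (hP : ∀ t, (Set.univ : Set S).Definable L (P t))
    (hd : Pairwise fun s t => Disjoint ({a s} ×ˢ P s) ({a t} ×ˢ P t)) :
    total μ (⋃ t, {a t} ×ˢ P t) = ∑ t, extend μ (P t) := by
  classical
  rw [← Finset.sum_fiberwise (s := Finset.univ) a, total]
  refine Finset.sum_congr rfl fun i _ => ?_
  rw [← hμ.extend_biUnion hP]
  · congr 1
    ext x
    simp [eq_comm]
  · intro s hs t ht hst
    refine Set.disjoint_left.2 fun x hx hx' => ?_
    have hs' : a s = i := by simpa using hs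
    have ht' : a t = i := by simpa using ht
    exact (Set.disjoint_left.1 (hd hst) : ∀ ⦃z⦄, _ → _) (show (i, x) ∈ _ from ⟨hs'.symm, hx⟩)
      ⟨ht'.symm, hx'⟩

lemma total_mono (hμ : IsInvariantMeasure L I μ) {ι : Type} [Fintype ι]
    {Y Z : Set (ι × (Fin n → S))} (hY : IsDefinable L Y) (hZ : IsDefinable L Z) (h : Y ⊆ Z) :
    total μ Y ≤ total μ Z :=
  Finset.sum_le_sum fun i _ => hμ.extend_mono (hY i) (hZ i) fun _ hx => h hx

lemma total_le_of_embeds (hμ : IsInvariantMeasure L I μ) (hI : IsIsomorphismGroup L I)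
    {ι κ : Type} [Fintype ι] [Fintype κ] {Y : Set (ι × (Fin n → S))} {Z : Set (κ × (Fin n → S))}
    (hZ : IsDefinable L Z) (h : Embeds L I Y Z) : total μ Y ≤ total μ Z := by
  classical
  obtain ⟨r, a, b, P, f, hP, hf, hd, rfl, hd', hsub⟩ := h
  have hfP := fun t => definable_image hI (hf t) (hP t)
  have hdef : IsDefinable L (⋃ t, {b t} ×ˢ (f t '' P t)) := fun j => by
    have : {x | (j, x) ∈ ⋃ t, {b t} ×ˢ (f t '' P t)} = ⋃ t : {t // b t = j}, f t '' P t := by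
      ext x
      simp [eq_comm]
    rw [this]
    exact Set.definable_iUnion_of_finite fun t => hfP t
  refine le_trans (le_of_eq ?_) (hμ.total_mono hdef hZ hsub)
  rw [hμ.total_iUnion hP hd, hμ.total_iUnion hfP hd']
  exact Finset.sum_congr rfl fun t _ => (hμ.extend_image hI (hf t) (hP t)).symm

lemma total_add_total_diff (hμ : IsInvariantMeasure L I μ) {ι : Type} [Fintype ι]
    {Y Z : Set (ι × (Fin n → S))} (hY : IsDefinable L Y) (hZ : IsDefinable L Z) (h : Y ⊆ Z) :
    total μ Y + total μ (Z \ Y) = total μ Z := by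
  rw [total, total, total, ← Finset.sum_add_distrib]
  refine Finset.sum_congr rfl fun i _ => ?_
  have h1 := hμ.extend_union (hY i) ((hZ i).sdiff (hY i)) Set.disjoint_sdiff_right
  refine h1.symm.trans (congrArg _ ?_)
  ext x
  have := @h (i, x)
  simp only [Set.mem_union, Set.mem_ofPred_eq, Set.mem_sdiff]
  tauto

/-- With `m = 3`, an almost embedding of `2 X` into `X` would give `2 ≤ 2 / 3 + 1`. -/
lemma not_almostEmbeds (hμ : IsInvariantMeasure L I μ) (hI : IsIsomorphismGroup L I)
    {X : L.DefinableSet (Set.univ : Set S) (Fin n)} (hX : μ X = 1) :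
    ¬ AlmostEmbeds L I (copies 2 (single L X)) (single L X) := by
  intro h
  obtain ⟨Y₀, hsub, hY₀, ⟨p, q, -, hq, hpq, hle⟩, hle'⟩ := h 3 (by norm_num)
  have hdef : IsDefinable L (copies 2 (single L X)) := (isDefinable_single X).copies 2
  have htot : total μ (copies 2 (single L X)) = 2 := by
    rw [total_copies, total_single, hX, mul_one, Nat.cast_ofNat]
  have h1 := hμ.total_le_of_embeds hI (hdef.copies q) hle
  have h2 := hμ.total_le_of_embeds hI (isDefinable_single X) hle'
  have h3 := hμ.total_add_total_diff hY₀ hdef hsub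
  rw [total_copies, total_copies, htot] at h1
  rw [total_single, hX] at h2
  rw [htot] at h3
  have hpq' : 3 * q ≤ p := by
    rw [le_div_iff₀ (by exact_mod_cast hq)] at hpq
    exact_mod_cast hpq
  have hfin : total μ Y₀ ≠ ⊤ := ne_top_of_le_ne_top ENNReal.ofNat_ne_top (h3 ▸ le_self_add)
  have hfin' : total μ (copies 2 (single L X) \ Y₀) ≠ ⊤ := ne_top_of_le_ne_top ENNReal.one_ne_top h2
  have r1 : (p : ℝ) * (total μ Y₀).toReal ≤ q * 2 := by
    have := ENNReal.toReal_mono (ENNReal.mul_ne_top (ENNReal.natCast_ne_top q)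
      ENNReal.ofNat_ne_top) h1
    simpa using this
  have r2 : (total μ (copies 2 (single L X) \ Y₀)).toReal ≤ 1 := by
    simpa using ENNReal.toReal_mono ENNReal.one_ne_top h2
  have r3 : (total μ Y₀).toReal + (total μ (copies 2 (single L X) \ Y₀)).toReal = 2 := by
    rw [← ENNReal.toReal_add hfin hfin', h3, ENNReal.toReal_ofNat]
  have r4 : (3 : ℝ) * q ≤ p := by exact_mod_cast hpq'
  have r5 : (0 : ℝ) < q := by exact_mod_cast hq
  nlinarith

end IsInvariantMeasure

end Obstruction

end DefinableTarski

theorem theorem1p2 (L : FirstOrder.Language.{u, v}) (S : Type w) [L.Structure S] (n : ℕ)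
    (I : Subgroup (Equiv.Perm (Fin n → S))) (hI : DefinableTarski.IsIsomorphismGroup L I)
    (X : L.DefinableSet (Set.univ : Set S) (Fin n)) :
    (¬ DefinableTarski.AlmostEmbeds L I
        (DefinableTarski.copies 2 (DefinableTarski.single L X)) (DefinableTarski.single L X)) ↔
      ∃ μ : L.DefinableSet (Set.univ : Set S) (Fin n) → ℝ≥0∞,
        DefinableTarski.IsInvariantMeasure L I μ ∧ μ X = 1 := by
  constructor
  · exact fun h => DefinableTarski.exists_measure hI X fun k hk =>
      h (DefinableTarski.almostEmbeds_of_countEmbeds hI X hk)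
  · rintro ⟨μ, hμ, hX⟩
    exact hμ.not_almostEmbeds hI hX
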